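/- Let $I$ be a finite set and let $A=(a_{ij})_{i,j\in I}$ be a symmetrizable generalized Cartan matrix: $a_{ii}=2$, $a_{ij}\in\mathbb{Z}_{\le 0}$ for $i\neq j$, $a_{ij}=0\iff a_{ji}=0$, and there are real numbers $d_i>0$ with $d_ia_{ij}=d_ja_{ji}$ for all $i,j\in I$; fix such $d_i$. Let $Q=\bigoplus_{i\in I}\mathbb{Z}\alpha_i$ be the root lattice of the associated Kac--Moody root system $\Delta$, let $W$ be its Weyl group, generated by the simple reflections $w_i(\alpha_j)=\alpha_j-a_{ij}\alpha_i$, and let $\Delta^{\mathrm{re}}=\{w\alpha_i : w\in W,\ i\in I\}$ be the set of real roots. Let $(\cdot,\cdot)$ be the symmetric bilinear form on $Q$ with $(\alpha_i,\alpha_j)=d_ia_{ij}$, and put $\|v\|^2=(v,v)$. Theorem. Suppose $\alpha,\beta,\alpha+\beta\in\Delta^{\mathrm{re}}$. (i) If $\|\alpha\|^2=\|\beta\|^2$, then $\|\alpha+\beta\|^2=a\|\alpha\|^2$ for some positive integer $a$. (ii) If $\|\alpha\|^2\neq\|\beta\|^2$, then $\|\alpha+\beta\|^2=\min(\|\alpha\|^2,\|\beta\|^2)$.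 -/

import Mathlib

namespace KacMoody

variable {ι : Type*} [Fintype ι] [DecidableEq ι]

/-- A generalized Cartan matrix: an integer matrix with diagonal entries `2`, nonpositive
off-diagonal entries, and a zero pattern that is symmetric. -/
structure IsGCM (A : Matrix ι ι ℤ) : Prop where
  diag : ∀ i, A i i = 2
  offDiag_nonpos : ∀ i j, i ≠ j → A i j ≤ 0
  zero_iff : ∀ i j, A i j = 0 ↔ A j i = 0

/-- The diagonal matrix with entries `d` symmetrizes `A`: all `d i` are positive and
`diag(d) * A` is symmetric. -/
structure IsSymmetrization (A : Matrix ι ι ℤ) (d : ι → ℝ) : Prop where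
  pos : ∀ i, 0 < d i
  symm : (Matrix.diagonal d * A.map (Int.cast : ℤ → ℝ)).IsSymm

/-- The simple root `α_i`, as a basis vector of the root lattice `ι → ℤ`. -/
def simpleRoot (i : ι) : ι → ℤ := Pi.single i 1

/-- The simple coroot `α_i^∨`, as a functional on the root lattice: `⟨α_i^∨, α_j⟩ = A i j`. -/
def simpleCoroot (A : Matrix ι ι ℤ) (i : ι) : Module.Dual ℤ (ι → ℤ) :=
  (LinearMap.proj i).comp A.mulVecLin

theorem simpleCoroot_simpleRoot (A : Matrix ι ι ℤ) (i j : ι) :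
    simpleCoroot A i (simpleRoot j) = A i j := by
  simp [simpleCoroot, simpleRoot]

theorem simpleCoroot_self {A : Matrix ι ι ℤ} (hA : IsGCM A) (i : ι) :
    simpleCoroot A i (simpleRoot i) = 2 := by
  rw [simpleCoroot_simpleRoot, hA.diag]

/-- The simple reflection `w_i : v ↦ v - ⟨α_i^∨, v⟩ α_i` of the root lattice. -/
def simpleReflection {A : Matrix ι ι ℤ} (hA : IsGCM A) (i : ι) : (ι → ℤ) ≃ₗ[ℤ] (ι → ℤ) :=
  Module.reflection (simpleCoroot_self hA i)

/-- The Weyl group, generated by the simple reflections. -/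
def weylGroup {A : Matrix ι ι ℤ} (hA : IsGCM A) : Subgroup ((ι → ℤ) ≃ₗ[ℤ] (ι → ℤ)) :=
  Subgroup.closure (Set.range (simpleReflection hA))

/-- The set of real roots: the images of the simple roots under the Weyl group. -/
def realRoots {A : Matrix ι ι ℤ} (hA : IsGCM A) : Set (ι → ℤ) :=
  {v | ∃ w ∈ weylGroup hA, ∃ i, v = w (simpleRoot i)}

/-- The symmetric bilinear form on the root lattice with matrix `diag(d) * A` in the basis of
simple roots, so that `(α_i, α_j) = d i * A i j`. -/
noncomputable def form (A : Matrix ι ι ℤ) (d : ι → ℝ) (u v : ι → ℤ) : ℝ :=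
  ∑ i, ∑ j, (u i : ℝ) * (d i * (A i j : ℝ)) * (v j : ℝ)

/-- The quadratic form `‖v‖² = (v, v)`. -/
noncomputable def normSq (A : Matrix ι ι ℤ) (d : ι → ℝ) (v : ι → ℤ) : ℝ :=
  form A d v v

end KacMoody

/-!
The proof uses only two properties of a real root `γ`: `‖γ‖² > 0`, and for every `v` in the root
lattice the number `2 (γ, v) / ‖γ‖²` is an integer. Both are clear for simple roots and carry over
to all real roots because the form is invariant under the Weyl group
(`normSq_pos_of_mem_realRoots`, `exists_two_mul_form_eq`).

If `‖α‖² = ‖β‖²` and `2 (α, β) = m ‖α‖²`, then `‖α + β‖² = (2 + m) ‖α‖²`, and `2 + m > 0` by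
positivity.

If `‖α‖² < ‖β‖²`, write `2 (α, β) = n ‖β‖²`, so that `‖α + β‖² = ‖α‖² + (1 + n) ‖β‖²`.
Positivity excludes `n ≤ -2`. If `n ≥ 0`, then `2 (α + β, α) = 2 ‖α‖² + n ‖β‖²` lies strictly
between `0` and `‖α + β‖²`, which contradicts integrality for the real root `α + β`. Hence `n = -1`
and `‖α + β‖² = ‖α‖²`.
-/

namespace KacMoody

section Form

variable {ι : Type*} [Fintype ι]

theorem form_add_left (A : Matrix ι ι ℤ) (d : ι → ℝ) (u v w : ι → ℤ) :
    form A d (u + v) w = form A d u w + form A d v w := by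
  simp [form, add_mul, Finset.sum_add_distrib]

theorem form_smul_left (A : Matrix ι ι ℤ) (d : ι → ℝ) (c : ℤ) (u v : ι → ℤ) :
    form A d (c • u) v = c * form A d u v := by
  simp [form, Finset.mul_sum, mul_assoc]

variable [DecidableEq ι]

theorem form_comm {A : Matrix ι ι ℤ} {d : ι → ℝ} (hd : IsSymmetrization A d) (u v : ι → ℤ) :
    form A d u v = form A d v u := by
  unfold form
  rw [Finset.sum_comm]
  refine Finset.sum_congr rfl fun j _ => Finset.sum_congr rfl fun i _ => ?_
  have h : d j * (A j i : ℝ) = d i * (A i j : ℝ) := by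
    simpa [Matrix.diagonal_mul] using hd.symm.apply i j
  rw [h]
  ring

theorem form_simpleRoot_left (A : Matrix ι ι ℤ) (d : ι → ℝ) (i : ι) (v : ι → ℤ) :
    form A d (simpleRoot i) v = d i * (simpleCoroot A i v : ℤ) := by
  simp [form, simpleRoot, simpleCoroot, Matrix.mulVec, dotProduct, Pi.single_apply,
    Finset.mul_sum, mul_assoc]

theorem normSq_simpleRoot {A : Matrix ι ι ℤ} (hA : IsGCM A) (d : ι → ℝ) (i : ι) :
    normSq A d (simpleRoot i) = 2 * d i := by
  rw [normSq, form_simpleRoot_left, simpleCoroot_self hA]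
  push_cast
  ring

theorem normSq_add {A : Matrix ι ι ℤ} {d : ι → ℝ} (hd : IsSymmetrization A d) (u v : ι → ℤ) :
    normSq A d (u + v) = normSq A d u + normSq A d v + 2 * form A d u v := by
  simp only [normSq]
  rw [form_add_left, form_comm hd u, form_comm hd v, form_add_left, form_add_left,
    form_comm hd v u]
  ring

end Form

section WeylGroup

variable {ι : Type*} [Fintype ι] [DecidableEq ι] {A : Matrix ι ι ℤ} {d : ι → ℝ}

theorem form_simpleReflection (hA : IsGCM A) (hd : IsSymmetrization A d) (i : ι) (u v : ι → ℤ) :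
    form A d (simpleReflection hA i u) (simpleReflection hA i v) = form A d u v := by
  have hs (x : ι → ℤ) :
      simpleReflection hA i x = x + (-simpleCoroot A i x) • simpleRoot i := by
    simp [simpleReflection, Module.reflection_apply, sub_eq_add_neg]
  rw [hs u, hs v, form_add_left, form_smul_left, form_comm hd u, form_add_left, form_smul_left,
    form_simpleRoot_left, form_simpleRoot_left, map_add, map_smul, simpleCoroot_self hA,
    form_comm hd v u]
  push_cast [smul_eq_mul]
  ring

theorem form_weylGroup (hA : IsGCM A) (hd : IsSymmetrization A d)
    {w : (ι → ℤ) ≃ₗ[ℤ] (ι → ℤ)} (hw : w ∈ weylGroup hA) (u v : ι → ℤ) :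
    form A d (w u) (w v) = form A d u v := by
  induction hw using Subgroup.closure_induction generalizing u v with
  | mem x hx =>
    obtain ⟨i, rfl⟩ := hx
    exact form_simpleReflection hA hd i u v
  | one => rfl
  | mul x y _ _ hx hy => rw [LinearEquiv.mul_apply, LinearEquiv.mul_apply, hx, hy]
  | inv x _ hx =>
    rw [← hx, ← LinearEquiv.mul_apply, ← LinearEquiv.mul_apply, mul_inv_cancel]
    rfl

theorem normSq_pos_of_mem_realRoots (hA : IsGCM A) (hd : IsSymmetrization A d) {γ : ι → ℤ}
    (hγ : γ ∈ realRoots hA) : 0 < normSq A d γ := by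
  obtain ⟨w, hw, i, rfl⟩ := hγ
  rw [normSq, form_weylGroup hA hd hw, ← normSq, normSq_simpleRoot hA]
  linarith [hd.pos i]

/-- Integrality of the coroot of a real root `γ`: the integer `k` is `⟨γ^∨, v⟩`. -/
theorem exists_two_mul_form_eq (hA : IsGCM A) (hd : IsSymmetrization A d) {γ : ι → ℤ}
    (hγ : γ ∈ realRoots hA) (v : ι → ℤ) :
    ∃ k : ℤ, 2 * form A d γ v = k * normSq A d γ := by
  obtain ⟨w, hw, i, rfl⟩ := hγ
  refine ⟨simpleCoroot A i (w⁻¹ v), ?_⟩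
  have hv : v = w (w⁻¹ v) := by
    rw [← LinearEquiv.mul_apply, mul_inv_cancel]
    rfl
  conv_lhs => rw [hv]
  rw [normSq, form_weylGroup hA hd hw, form_weylGroup hA hd hw, ← normSq, normSq_simpleRoot hA,
    form_simpleRoot_left]
  ring

end WeylGroup

section Sum

variable {ι : Type*} [Fintype ι] [DecidableEq ι] {A : Matrix ι ι ℤ} {d : ι → ℝ}

theorem exists_normSq_add_eq_of_normSq_eq (hA : IsGCM A) (hd : IsSymmetrization A d)
    {α β : ι → ℤ} (hα : α ∈ realRoots hA) (hαβ : α + β ∈ realRoots hA)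
    (h : normSq A d α = normSq A d β) :
    ∃ a : ℕ, 0 < a ∧ normSq A d (α + β) = (a : ℝ) * normSq A d α := by
  obtain ⟨m, hm⟩ := exists_two_mul_form_eq hA hd hα β
  have hsum : normSq A d (α + β) = ((2 + m : ℤ) : ℝ) * normSq A d α := by
    rw [normSq_add hd, ← h, hm]
    push_cast
    ring
  have hpos : 0 < 2 + m := by
    have := normSq_pos_of_mem_realRoots hA hd hαβ
    rw [hsum] at this
    exact_mod_cast pos_of_mul_pos_left this (normSq_pos_of_mem_realRoots hA hd hα).le
  lift 2 + m to ℕ using hpos.le with a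
  exact ⟨a, by exact_mod_cast hpos, by exact_mod_cast hsum⟩

theorem normSq_add_eq_of_normSq_lt (hA : IsGCM A) (hd : IsSymmetrization A d)
    {α β : ι → ℤ} (hα : α ∈ realRoots hA) (hβ : β ∈ realRoots hA) (hαβ : α + β ∈ realRoots hA)
    (h : normSq A d α < normSq A d β) : normSq A d (α + β) = normSq A d α := by
  have hα0 := normSq_pos_of_mem_realRoots hA hd hα
  have hβ0 := normSq_pos_of_mem_realRoots hA hd hβ
  have hγ0 := normSq_pos_of_mem_realRoots hA hd hαβ
  obtain ⟨n, hn⟩ := exists_two_mul_form_eq hA hd hβ α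
  obtain ⟨k, hk⟩ := exists_two_mul_form_eq hA hd hαβ α
  have hsum : normSq A d (α + β) = normSq A d α + (1 + n) * normSq A d β := by
    rw [normSq_add hd, form_comm hd α β, hn]
    ring
  have hpair : 2 * form A d (α + β) α = 2 * normSq A d α + n * normSq A d β := by
    rw [form_add_left, mul_add, hn, ← normSq]
  have hlower : -2 < n := by
    by_contra! hle
    have hle' : (n : ℝ) ≤ -2 := by exact_mod_cast hle
    nlinarith
  have hupper : n < 0 := by
    by_contra! hge
    have hge' : (0 : ℝ) ≤ n := by exact_mod_cast hge
    have hnβ : 0 ≤ (n : ℝ) * normSq A d β := by positivity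
    -- `⟨(α + β)^∨, α⟩` would be an integer strictly between `0` and `1`.
    have hk0 : 0 < k := by
      have : 0 < (k : ℝ) * normSq A d (α + β) := by linarith
      exact_mod_cast pos_of_mul_pos_left this hγ0.le
    have hk1 : k < 1 := by
      have : (k : ℝ) * normSq A d (α + β) < 1 * normSq A d (α + β) := by linarith
      exact_mod_cast lt_of_mul_lt_mul_right this hγ0.le
    omega
  obtain rfl : n = -1 := by omega
  rw [hsum]
  push_cast
  ring

end Sum

end KacMoody

theorem mainTheorem9 {ι : Type*} [Fintype ι] [DecidableEq ι]
    (A : Matrix ι ι ℤ) (hA : KacMoody.IsGCM A)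
    (d : ι → ℝ) (hd : KacMoody.IsSymmetrization A d)
    (α β : ι → ℤ) (hα : α ∈ KacMoody.realRoots hA) (hβ : β ∈ KacMoody.realRoots hA)
    (hαβ : α + β ∈ KacMoody.realRoots hA) :
    (KacMoody.normSq A d α = KacMoody.normSq A d β →
      ∃ a : ℕ, 0 < a ∧ KacMoody.normSq A d (α + β) = (a : ℝ) * KacMoody.normSq A d α) ∧
    (KacMoody.normSq A d α ≠ KacMoody.normSq A d β →
      KacMoody.normSq A d (α + β) =
        min (KacMoody.normSq A d α) (KacMoody.normSq A d β)) := by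
  refine ⟨KacMoody.exists_normSq_add_eq_of_normSq_eq hA hd hα hαβ, fun h => ?_⟩
  rcases h.lt_or_gt with h | h
  · rw [min_eq_left h.le, KacMoody.normSq_add_eq_of_normSq_lt hA hd hα hβ hαβ h]
  · rw [min_eq_right h.le, add_comm α β]
    exact KacMoody.normSq_add_eq_of_normSq_lt hA hd hβ hα (add_comm α β ▸ hαβ) h
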